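/- Let $G(x,y)=\sum_{i,j\ge 0} g_{ij}x^iy^j$ be a formal power series with real coefficients such that the equation $y=G(x,y)$ is \emph{well-conditioned}, that is: (a) all $g_{ij}\ge 0$; (b) $G$ is holomorphic in a neighborhood of the origin of $\mathbb{C}^2$; (c) $G(0,y)=0$; (d) $G(x,0)\neq 0$; (e) $1-G_y(0,0)\neq 0$; (f) $G_y\neq 0$; (g) $G_{yy}\neq 0$. Here $G_y=\partial G/\partial y$ and $G_{yy}$ denote formal partial derivatives. A \emph{characteristic point} of the equation is a pair $(a,b)$ of positive real numbers such that the series $G$ and $G_y$ converge at $(a,b)$ and $$b=G(a,b),\qquad 1=G_y(a,b);$$ it may lie in the interior or on the boundary of the domain of convergence of $G$. Then the equation has at most one characteristic point. Moreover, there is a unique formal power series $T(x)$ with nonnegative coefficients and $T(0)=0$ that satisfies the formal identity $T(x)=G(x,T(x))$ (the \emph{standard solution}), and if $(a,b)$ is a characteristic point, then $(a,b)$ is the \emph{extreme point} $(\rho,\tau)$ of $T$: $a=\rho$ is the radius of convergence of $T$, and $T$ converges at $\rho$ with $b=\tau=T(\rho)$. -/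

import Mathlib

/-!
One-equation systems `y = G(x, y)`, where `G` is a formal power series in two variables with
real coefficients. The variable with index `0` is `x` and the variable with index `1` is `y`.
-/

noncomputable section

namespace OneEq

/-- The power series `F(x, y)` converges at `(a, b)`, as an unconditional sum, to the value `v`. -/
def HasValue (F : MvPowerSeries (Fin 2) ℝ) (a b v : ℝ) : Prop :=
  HasSum (fun d : Fin 2 →₀ ℕ => MvPowerSeries.coeff d F * a ^ d 0 * b ^ d 1) v

/-- The formal partial derivative `∂F/∂y`. For a single equation `y = G(x, y)` this is the
Jacobian `J_G`, a `1 × 1` matrix. -/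
def dy (F : MvPowerSeries (Fin 2) ℝ) : MvPowerSeries (Fin 2) ℝ :=
  MvPowerSeries.pderiv ℝ 1 F

/-- The equation `y = G(x, y)` is well-conditioned. -/
structure WellConditioned (G : MvPowerSeries (Fin 2) ℝ) : Prop where
  /-- `G` has nonnegative coefficients -/
  nonneg : ∀ d, 0 ≤ MvPowerSeries.coeff d G
  /-- `G` defines a holomorphic function near the origin: the power series converges on some
  complex polydisc centered at the origin -/
  holomorphic : ∃ r : ℝ, 0 < r ∧ ∀ x y : ℂ, ‖x‖ < r → ‖y‖ < r →
    Summable fun d : Fin 2 →₀ ℕ => ((MvPowerSeries.coeff d G : ℝ) : ℂ) * x ^ d 0 * y ^ d 1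
  /-- `G(0, y) = 0` -/
  zero_left : ∀ n : ℕ, MvPowerSeries.coeff (Finsupp.single 1 n) G = 0
  /-- `G(x, 0) ≠ 0` -/
  zero_right : ∃ n : ℕ, MvPowerSeries.coeff (Finsupp.single 0 n) G ≠ 0
  /-- `det (I - J_G(0, 0)) ≠ 0` -/
  det_ne_zero : 1 - MvPowerSeries.constantCoeff (dy G) ≠ 0
  /-- the system is irreducible: the `1 × 1` matrix `J_G` is not zero -/
  irreducible : dy G ≠ 0
  /-- `∂²G/∂y² ≠ 0`, so the equation is nonlinear in `y` -/
  nonlinear : dy (dy G) ≠ 0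

/-- `T` is a standard solution of `y = G(x, y)`: a formal power series with nonnegative
coefficients and zero constant term (so that the composition is defined) that satisfies the
formal identity `T(x) = G(x, T(x))`. -/
structure IsStandardSolution (G : MvPowerSeries (Fin 2) ℝ) (T : PowerSeries ℝ) : Prop where
  nonneg : ∀ n, 0 ≤ PowerSeries.coeff n T
  constantCoeff_eq_zero : PowerSeries.constantCoeff T = 0
  eq_subst : T = MvPowerSeries.subst (![PowerSeries.X, T] : Fin 2 → PowerSeries ℝ) G

/-- `(ρ, τ)` is the extreme point of `T`: the radius of convergence of `T` is the positive real
number `ρ`, and `T` converges at `ρ` to `τ`. -/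
structure IsExtremePoint (T : PowerSeries ℝ) (ρ τ : ℝ) : Prop where
  pos : 0 < ρ
  radius_eq : (FormalMultilinearSeries.ofScalars ℝ fun n => PowerSeries.coeff n T).radius
    = ENNReal.ofReal ρ
  hasSum : HasSum (fun n => PowerSeries.coeff n T * ρ ^ n) τ

/-- The characteristic points of `y = G(x, y)`: the positive solutions `(a, b)` of the
characteristic system `y = G(x, y)`, `0 = 1 - G_y(x, y)`. They may lie in the interior or on the
boundary of the positive domain of `G`; the derivative is the formal one. -/
def charPoints (G : MvPowerSeries (Fin 2) ℝ) : Set (ℝ × ℝ) :=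
  {p | 0 < p.1 ∧ 0 < p.2 ∧ HasValue G p.1 p.2 p.2 ∧ HasValue (dy G) p.1 p.2 1}

end OneEq

end

/-! Since `G(0, y) = 0`, every monomial of `G` carries a factor `x`, so `T ↦ G(x, T)` is an `X`-adic
contraction; its iterates from `0` converge to the only solution `T`, with nonnegative coefficients.
Evaluated in `[0, ∞]`, the identity `T(x) = G(x, T(x))` holds at every `x`, and `T(x)` is the least
`y` with `G(x, y) ≤ y` (`eval_solution_le`). At a characteristic point `(a, b)` the graph of `G(a,
·)` is strictly convex, as `G_yy ≠ 0`, and tangent to the diagonal at `b`, so `y < G(a, y)` for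
every other `y ≥ 0` of convergence (`lt_of_hasValue`). Hence the finite fixed point `T(a) ≤ b`
equals `b`. Convergence at some `x > a` would give `y = T(x) > b` with `G(a, y) ≤ G(x, y) = y`, a
contradiction, so `a` is the radius. Two characteristic points are both the extreme point of the
same `T`, so they coincide. -/

open scoped ENNReal NNReal

namespace OneEq

/-! ### Formal composition and the `X`-adic fixed point -/

section Substitution

variable {G : MvPowerSeries (Fin 2) ℝ} {S T : PowerSeries ℝ}

/-- The operator `T(x) ↦ G(x, T(x))` on formal power series. -/
noncomputable def substOp (G : MvPowerSeries (Fin 2) ℝ) (T : PowerSeries ℝ) : PowerSeries ℝ :=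
  MvPowerSeries.subst (![PowerSeries.X, T] : Fin 2 → PowerSeries ℝ) G

theorem hasSubst_of_constantCoeff_eq_zero (hT : PowerSeries.constantCoeff T = 0) :
    MvPowerSeries.HasSubst (![PowerSeries.X, T] : Fin 2 → PowerSeries ℝ) := by
  refine MvPowerSeries.hasSubst_of_constantCoeff_zero fun s => ?_
  fin_cases s
  · exact PowerSeries.constantCoeff_X
  · exact hT

theorem prod_cons_X (T : PowerSeries ℝ) (d : Fin 2 →₀ ℕ) :
    (d.prod fun s e => (![PowerSeries.X, T] : Fin 2 → PowerSeries ℝ) s ^ e)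
      = PowerSeries.X ^ d 0 * T ^ d 1 := by
  rw [Finsupp.prod_fintype _ _ (fun _ => pow_zero _), Fin.prod_univ_two]
  rfl

theorem coeff_substOp (hT : PowerSeries.constantCoeff T = 0) (n : ℕ) :
    PowerSeries.coeff n (substOp G T) = ∑ᶠ d : Fin 2 →₀ ℕ,
      MvPowerSeries.coeff d G * PowerSeries.coeff n (PowerSeries.X ^ d 0 * T ^ d 1) := by
  simp only [← prod_cons_X]
  exact MvPowerSeries.coeff_subst (hasSubst_of_constantCoeff_eq_zero hT) G _

theorem finite_support_coeff_substOp (hT : PowerSeries.constantCoeff T = 0) (n : ℕ) :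
    (Function.support fun d : Fin 2 →₀ ℕ => MvPowerSeries.coeff d G *
      PowerSeries.coeff n (PowerSeries.X ^ d 0 * T ^ d 1)).Finite := by
  simp only [← prod_cons_X]
  exact MvPowerSeries.coeff_subst_finite (hasSubst_of_constantCoeff_eq_zero hT) G _

theorem coeff_eq_zero_of_apply_zero (hG : ∀ n : ℕ, MvPowerSeries.coeff (Finsupp.single 1 n) G = 0)
    {d : Fin 2 →₀ ℕ} (hd : d 0 = 0) : MvPowerSeries.coeff d G = 0 := by
  convert hG (d 1)
  ext i
  fin_cases i <;> simp [hd]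

theorem constantCoeff_substOp (hG : ∀ n : ℕ, MvPowerSeries.coeff (Finsupp.single 1 n) G = 0)
    (hT : PowerSeries.constantCoeff T = 0) : PowerSeries.constantCoeff (substOp G T) = 0 := by
  rw [← PowerSeries.coeff_zero_eq_constantCoeff_apply, coeff_substOp hT]
  refine finsum_eq_zero_of_forall_eq_zero fun d => ?_
  by_cases hd : d 0 = 0
  · rw [coeff_eq_zero_of_apply_zero hG hd, zero_mul]
  · simp [hd]

/-- The operator `T(x) ↦ G(x, T(x))` is a contraction for the `X`-adic topology. -/
theorem X_pow_succ_dvd_substOp_sub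
    (hG : ∀ n : ℕ, MvPowerSeries.coeff (Finsupp.single 1 n) G = 0)
    (hS : PowerSeries.constantCoeff S = 0) (hT : PowerSeries.constantCoeff T = 0) {n : ℕ}
    (h : (PowerSeries.X : PowerSeries ℝ) ^ n ∣ S - T) :
    (PowerSeries.X : PowerSeries ℝ) ^ (n + 1) ∣ substOp G S - substOp G T := by
  rw [PowerSeries.X_pow_dvd_iff]
  intro m hm
  rw [map_sub, sub_eq_zero, coeff_substOp hS, coeff_substOp hT]
  refine finsum_congr fun d => ?_
  by_cases hd : d 0 = 0
  · rw [coeff_eq_zero_of_apply_zero hG hd, zero_mul, zero_mul]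
  · obtain ⟨k, hk⟩ := Nat.exists_eq_succ_of_ne_zero hd
    congr 1
    rw [← sub_eq_zero, ← map_sub, ← mul_sub]
    refine PowerSeries.X_pow_dvd_iff.1 ?_ m hm
    -- One factor `X` comes from `d 0 ≥ 1`, the other `n` from `S - T`, which divides the difference
    -- of powers.
    rw [pow_succ', hk, pow_succ']
    exact mul_dvd_mul (Dvd.intro _ rfl) (h.trans (sub_dvd_pow_sub_pow S T _))

theorem coeff_mul_nonneg (hS : ∀ n, 0 ≤ PowerSeries.coeff n S)
    (hT : ∀ n, 0 ≤ PowerSeries.coeff n T) (n : ℕ) : 0 ≤ PowerSeries.coeff n (S * T) := by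
  rw [PowerSeries.coeff_mul]
  exact Finset.sum_nonneg fun p _ => mul_nonneg (hS _) (hT _)

theorem coeff_pow_nonneg (hT : ∀ n, 0 ≤ PowerSeries.coeff n T) (k n : ℕ) :
    0 ≤ PowerSeries.coeff n (T ^ k) := by
  induction k generalizing n with
  | zero => rw [pow_zero, PowerSeries.coeff_one]; split_ifs <;> norm_num
  | succ k ih => rw [pow_succ]; exact coeff_mul_nonneg ih hT n

theorem coeff_X_nonneg (n : ℕ) : 0 ≤ PowerSeries.coeff n (PowerSeries.X : PowerSeries ℝ) := by
  rw [PowerSeries.coeff_X]; split_ifs <;> norm_num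

theorem coeff_X_pow_mul_pow_nonneg (hT : ∀ n, 0 ≤ PowerSeries.coeff n T) (i j n : ℕ) :
    0 ≤ PowerSeries.coeff n (PowerSeries.X ^ i * T ^ j) :=
  coeff_mul_nonneg (coeff_pow_nonneg coeff_X_nonneg i) (coeff_pow_nonneg hT j) n

theorem coeff_substOp_nonneg (hG : ∀ d, 0 ≤ MvPowerSeries.coeff d G)
    (hT₀ : PowerSeries.constantCoeff T = 0) (hT : ∀ n, 0 ≤ PowerSeries.coeff n T) (n : ℕ) :
    0 ≤ PowerSeries.coeff n (substOp G T) := by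
  rw [coeff_substOp hT₀]
  exact finsum_nonneg fun d => mul_nonneg (hG d) (coeff_X_pow_mul_pow_nonneg hT _ _ n)

/-- The iterates of `T(x) ↦ G(x, T(x))`, starting from `0`. -/
noncomputable def iter (G : MvPowerSeries (Fin 2) ℝ) (n : ℕ) : PowerSeries ℝ :=
  (substOp G)^[n] 0

theorem iter_succ (G : MvPowerSeries (Fin 2) ℝ) (n : ℕ) :
    iter G (n + 1) = substOp G (iter G n) :=
  Function.iterate_succ_apply' _ _ _

theorem constantCoeff_iter (hG : ∀ n : ℕ, MvPowerSeries.coeff (Finsupp.single 1 n) G = 0)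
    (n : ℕ) : PowerSeries.constantCoeff (iter G n) = 0 := by
  induction n with
  | zero => exact map_zero _
  | succ n ih => rw [iter_succ]; exact constantCoeff_substOp hG ih

theorem coeff_iter_nonneg (hG : WellConditioned G) (k n : ℕ) :
    0 ≤ PowerSeries.coeff n (iter G k) := by
  induction k generalizing n with
  | zero => exact (map_zero (PowerSeries.coeff n)).ge
  | succ k ih =>
    rw [iter_succ]
    exact coeff_substOp_nonneg hG.nonneg (constantCoeff_iter hG.zero_left k) ih n

/-- The standard solution, as the `X`-adic limit of the iterates. -/
noncomputable def solution (G : MvPowerSeries (Fin 2) ℝ) : PowerSeries ℝ :=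
  -- The iterate of index `n + 1` is already final modulo `X ^ (n + 1)`.
  PowerSeries.mk fun n => PowerSeries.coeff n (iter G (n + 1))

theorem X_pow_dvd_iter_succ_sub (hG : ∀ n : ℕ, MvPowerSeries.coeff (Finsupp.single 1 n) G = 0)
    (n : ℕ) : (PowerSeries.X : PowerSeries ℝ) ^ n ∣ iter G (n + 1) - iter G n := by
  induction n with
  | zero => simp
  | succ n ih =>
    have h := X_pow_succ_dvd_substOp_sub hG (constantCoeff_iter hG _) (constantCoeff_iter hG _) ih
    rwa [← iter_succ, ← iter_succ] at h

theorem coeff_iter_eq (hG : ∀ n : ℕ, MvPowerSeries.coeff (Finsupp.single 1 n) G = 0)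
    {m n : ℕ} (h : m < n) :
    PowerSeries.coeff m (iter G n) = PowerSeries.coeff m (solution G) := by
  rw [solution, PowerSeries.coeff_mk]
  induction n, (h : m + 1 ≤ n) using Nat.le_induction with
  | base => rfl
  | succ n hn ih =>
    rw [← ih, ← sub_eq_zero, ← map_sub]
    exact PowerSeries.X_pow_dvd_iff.1 (X_pow_dvd_iter_succ_sub hG n) m hn

theorem X_pow_dvd_solution_sub (hG : ∀ n : ℕ, MvPowerSeries.coeff (Finsupp.single 1 n) G = 0)
    (n : ℕ) : (PowerSeries.X : PowerSeries ℝ) ^ n ∣ solution G - iter G n :=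
  PowerSeries.X_pow_dvd_iff.2 fun m hm => by rw [map_sub, coeff_iter_eq hG hm, sub_self]

theorem isStandardSolution_solution (hG : WellConditioned G) :
    IsStandardSolution G (solution G) := by
  have h₀ : PowerSeries.constantCoeff (solution G) = 0 := by
    rw [← PowerSeries.coeff_zero_eq_constantCoeff_apply, ← coeff_iter_eq hG.zero_left one_pos,
      PowerSeries.coeff_zero_eq_constantCoeff_apply, constantCoeff_iter hG.zero_left]
  refine ⟨fun n => ?_, h₀, ?_⟩
  · rw [← coeff_iter_eq hG.zero_left n.lt_succ_self]
    exact coeff_iter_nonneg hG _ _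
  · change solution G = substOp G (solution G)
    ext n
    have h := X_pow_succ_dvd_substOp_sub hG.zero_left h₀ (constantCoeff_iter hG.zero_left n)
      (X_pow_dvd_solution_sub hG.zero_left n)
    rw [← iter_succ] at h
    have h' := PowerSeries.X_pow_dvd_iff.1 h n n.lt_succ_self
    rw [map_sub, coeff_iter_eq hG.zero_left n.lt_succ_self, sub_eq_zero] at h'
    exact h'.symm

theorem IsStandardSolution.unique (hG : WellConditioned G) (hS : IsStandardSolution G S)
    (hT : IsStandardSolution G T) : S = T := by
  have h (n : ℕ) : (PowerSeries.X : PowerSeries ℝ) ^ n ∣ S - T := by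
    induction n with
    | zero => simp
    | succ n ih =>
      have := X_pow_succ_dvd_substOp_sub hG.zero_left hS.constantCoeff_eq_zero
        hT.constantCoeff_eq_zero ih
      rwa [substOp, substOp, ← hS.eq_subst, ← hT.eq_subst] at this
  ext n
  have := PowerSeries.X_pow_dvd_iff.1 (h (n + 1)) n n.lt_succ_self
  rwa [map_sub, sub_eq_zero] at this

end Substitution

/-! ### Evaluation in `[0, ∞]` and minimality of the solution -/

section Evaluation

variable {G : MvPowerSeries (Fin 2) ℝ} {S T : PowerSeries ℝ}

theorem hasSum_iff_tsum_ofReal {ι : Type*} {f : ι → ℝ} (hf : ∀ i, 0 ≤ f i) {s : ℝ} (hs : 0 ≤ s) :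
    HasSum f s ↔ ∑' i, ENNReal.ofReal (f i) = ENNReal.ofReal s := by
  constructor
  · intro h
    rw [← ENNReal.ofReal_tsum_of_nonneg hf h.summable, h.tsum_eq]
  · intro h
    have hsum : Summable f := by
      have := ENNReal.summable_toReal (h.trans_ne ENNReal.ofReal_ne_top)
      simpa only [ENNReal.toReal_ofReal (hf _)] using this
    rw [← ENNReal.ofReal_tsum_of_nonneg hf hsum,
      ENNReal.ofReal_eq_ofReal_iff (tsum_nonneg hf) hs] at h
    exact h ▸ hsum.hasSum

/-- The value in `[0, ∞]` of a power series with nonnegative coefficients. -/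
noncomputable def eval (T : PowerSeries ℝ) (x : ℝ≥0∞) : ℝ≥0∞ :=
  ∑' n, ENNReal.ofReal (PowerSeries.coeff n T) * x ^ n

/-- The value in `[0, ∞]` of a power series in two variables with nonnegative coefficients. -/
noncomputable def eval₂ (G : MvPowerSeries (Fin 2) ℝ) (x y : ℝ≥0∞) : ℝ≥0∞ :=
  ∑' d : Fin 2 →₀ ℕ, ENNReal.ofReal (MvPowerSeries.coeff d G) * (x ^ d 0 * y ^ d 1)

/-- The Cauchy product is a regrouping along antidiagonals, which needs no convergence in `[0, ∞]`.
-/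
theorem eval_mul (hS : ∀ n, 0 ≤ PowerSeries.coeff n S) (hT : ∀ n, 0 ≤ PowerSeries.coeff n T)
    (x : ℝ≥0∞) : eval (S * T) x = eval S x * eval T x := by
  simp only [eval]
  rw [← ENNReal.tsum_mul_right]
  simp only [← ENNReal.tsum_mul_left]
  rw [← ENNReal.tsum_prod (f := fun i j => ENNReal.ofReal (PowerSeries.coeff i S) * x ^ i *
    (ENNReal.ofReal (PowerSeries.coeff j T) * x ^ j)),
    ← Finset.HasAntidiagonal.sigmaAntidiagonalEquivProd.tsum_eq, ENNReal.tsum_sigma']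
  refine tsum_congr fun n => ?_
  rw [PowerSeries.coeff_mul, ENNReal.ofReal_sum_of_nonneg fun p _ => mul_nonneg (hS _) (hT _),
    Finset.sum_mul, tsum_fintype, ← Finset.sum_coe_sort]
  refine Finset.sum_congr rfl fun p _ => ?_
  have hp : x ^ n = x ^ p.1.1 * x ^ p.1.2 := by
    rw [← pow_add, Finset.HasAntidiagonal.mem_antidiagonal.1 p.2]
  simp only [Finset.HasAntidiagonal.sigmaAntidiagonalEquivProd_apply]
  rw [ENNReal.ofReal_mul (hS _), hp]
  ring

theorem eval_X (x : ℝ≥0∞) : eval PowerSeries.X x = x := by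
  rw [eval, tsum_eq_single 1]
  · simp
  · intro n hn
    simp [PowerSeries.coeff_X, hn]

theorem eval_one (x : ℝ≥0∞) : eval 1 x = 1 := by
  rw [eval, tsum_eq_single 0]
  · simp
  · intro n hn
    simp [PowerSeries.coeff_one, hn]

theorem eval_pow (hT : ∀ n, 0 ≤ PowerSeries.coeff n T) (k : ℕ) (x : ℝ≥0∞) :
    eval (T ^ k) x = eval T x ^ k := by
  induction k with
  | zero => rw [pow_zero, pow_zero, eval_one]
  | succ k ih => rw [pow_succ, pow_succ, eval_mul (coeff_pow_nonneg hT k) hT, ih]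

theorem eval_substOp (hG : ∀ d, 0 ≤ MvPowerSeries.coeff d G)
    (hT₀ : PowerSeries.constantCoeff T = 0) (hT : ∀ n, 0 ≤ PowerSeries.coeff n T) (x : ℝ≥0∞) :
    eval (substOp G T) x = eval₂ G x (eval T x) := by
  have h (d : Fin 2 →₀ ℕ) : x ^ d 0 * eval T x ^ d 1
      = eval (PowerSeries.X ^ d 0 * T ^ d 1) x := by
    rw [eval_mul (coeff_pow_nonneg coeff_X_nonneg _) (coeff_pow_nonneg hT _), eval_pow hT,
      eval_pow coeff_X_nonneg, eval_X]
  simp only [eval₂, h]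
  simp only [eval, ← ENNReal.tsum_mul_left]
  -- Tonelli: compare the coefficients of each `x ^ n`.
  rw [ENNReal.tsum_comm]
  refine tsum_congr fun n => ?_
  have hfin := finite_support_coeff_substOp (G := G) hT₀ n
  rw [coeff_substOp hT₀, ← tsum_eq_finsum (L := .unconditional _) hfin, ENNReal.ofReal_tsum_of_nonneg
    (fun d => mul_nonneg (hG d) (coeff_X_pow_mul_pow_nonneg hT _ _ n))
    (summable_of_hasFiniteSupport hfin), ← ENNReal.tsum_mul_right]
  refine tsum_congr fun d => ?_
  rw [ENNReal.ofReal_mul (hG d), mul_assoc]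

theorem eval₂_mono (G : MvPowerSeries (Fin 2) ℝ) {x x' y y' : ℝ≥0∞} (hx : x ≤ x') (hy : y ≤ y') :
    eval₂ G x y ≤ eval₂ G x' y' :=
  ENNReal.tsum_le_tsum fun d => by gcongr

theorem hasValue_iff_eval₂ (hG : ∀ d, 0 ≤ MvPowerSeries.coeff d G) {a b v : ℝ} (ha : 0 ≤ a)
    (hb : 0 ≤ b) (hv : 0 ≤ v) :
    HasValue G a b v ↔ eval₂ G (ENNReal.ofReal a) (ENNReal.ofReal b) = ENNReal.ofReal v := by
  rw [HasValue, hasSum_iff_tsum_ofReal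
    (fun d => mul_nonneg (mul_nonneg (hG d) (pow_nonneg ha _)) (pow_nonneg hb _)) hv, eval₂]
  simp only [mul_assoc, ENNReal.ofReal_mul (hG _), ENNReal.ofReal_mul (pow_nonneg ha _),
    ENNReal.ofReal_pow ha, ENNReal.ofReal_pow hb]

theorem hasSum_iff_eval (hT : ∀ n, 0 ≤ PowerSeries.coeff n T) {a v : ℝ} (ha : 0 ≤ a)
    (hv : 0 ≤ v) : HasSum (fun n => PowerSeries.coeff n T * a ^ n) v ↔
      eval T (ENNReal.ofReal a) = ENNReal.ofReal v := by
  rw [hasSum_iff_tsum_ofReal (fun n => mul_nonneg (hT n) (pow_nonneg ha n)) hv, eval]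
  simp only [ENNReal.ofReal_mul (hT _), ENNReal.ofReal_pow ha]

theorem eval_eq_eval₂ (hG : WellConditioned G) (hT : IsStandardSolution G T) (x : ℝ≥0∞) :
    eval T x = eval₂ G x (eval T x) := by
  conv_lhs => rw [hT.eq_subst]
  exact eval_substOp hG.nonneg hT.constantCoeff_eq_zero hT.nonneg x

/-- The standard solution is the least solution of `y = G(x, y)`. -/
theorem eval_solution_le (hG : WellConditioned G) {x y : ℝ≥0∞} (h : eval₂ G x y ≤ y) :
    eval (solution G) x ≤ y := by
  have hiter (n : ℕ) : eval (iter G n) x ≤ y := by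
    induction n with
    | zero => simp [iter, eval]
    | succ n ih =>
      rw [iter_succ, eval_substOp hG.nonneg (constantCoeff_iter hG.zero_left n)
        (coeff_iter_nonneg hG n)]
      exact (eval₂_mono G le_rfl ih).trans h
  refine ENNReal.tsum_le_of_sum_range_le fun n => ?_
  refine le_trans ?_ (hiter n)
  rw [Finset.sum_congr rfl fun m hm => by
    rw [← coeff_iter_eq hG.zero_left (Finset.mem_range.1 hm)]]
  exact ENNReal.sum_le_tsum _

end Evaluation

/-! ### Strict convexity at a characteristic point -/

section Tangent

variable {G : MvPowerSeries (Fin 2) ℝ}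

/-- The tangent to `y ^ (k + 1)` at `b`, times `y`, is the tangent to `y ^ (k + 2)` plus `(k + 1) *
b ^ k * (y - b) ^ 2`. This square drives the induction, and makes the inequality strict in
`tangent_lt_pow`. -/
theorem tangent_le_pow {b y : ℝ} (hb : 0 ≤ b) (hy : 0 ≤ y) (j : ℕ) :
    b ^ j + j * b ^ (j - 1) * (y - b) ≤ y ^ j := by
  rcases j with _ | k
  · simp
  · rw [Nat.add_sub_cancel]
    induction k with
    | zero => simp
    | succ k ih =>
      have h₁ := mul_le_mul_of_nonneg_left ih hy
      have h₂ : 0 ≤ ((k + 1 : ℕ) : ℝ) * b ^ k * (y - b) ^ 2 := by positivity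
      push_cast at *
      calc _ = y * (b ^ (k + 1) + (k + 1) * b ^ k * (y - b)) - (k + 1) * b ^ k * (y - b) ^ 2 := by
            ring
        _ ≤ y * y ^ (k + 1) := by linarith
        _ = _ := by ring

theorem tangent_lt_pow {b y : ℝ} (hb : 0 < b) (hy : 0 ≤ y) (hne : y ≠ b) {j : ℕ} (hj : 2 ≤ j) :
    b ^ j + j * b ^ (j - 1) * (y - b) < y ^ j := by
  obtain ⟨k, rfl⟩ := Nat.exists_eq_add_of_le' hj
  have h₁ := mul_le_mul_of_nonneg_left (tangent_le_pow hb.le hy (k + 1)) hy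
  have h₂ : 0 < ((k + 1 : ℕ) : ℝ) * b ^ k * (y - b) ^ 2 := by
    have := sub_ne_zero.2 hne
    positivity
  simp only [Nat.add_sub_cancel, show k + 2 - 1 = k + 1 from rfl] at *
  push_cast at *
  calc _ = y * (b ^ (k + 1) + (k + 1) * b ^ k * (y - b)) - (k + 1) * b ^ k * (y - b) ^ 2 := by
        ring
    _ < y * y ^ (k + 1) := by linarith
    _ = _ := by ring

/-- Shifting the exponent of `y` by one misses only the terms with `d 1 = 0`, which the factor `d 1`
kills. -/
theorem hasSum_of_hasValue_dy {a b v : ℝ} (h : HasValue (dy G) a b v) :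
    HasSum (fun d : Fin 2 →₀ ℕ =>
      MvPowerSeries.coeff d G * a ^ d 0 * (d 1 * b ^ (d 1 - 1))) v := by
  have hinj : Function.Injective fun d : Fin 2 →₀ ℕ => d + Finsupp.single 1 1 :=
    add_left_injective _
  rw [← hinj.hasSum_iff]
  · refine (congrArg (HasSum · v) (funext fun d => ?_)).mpr h
    rw [dy, MvPowerSeries.coeff_pderiv]
    simp
    ring
  · intro d hd
    have : d 1 = 0 := by
      by_contra h0
      refine hd ⟨d - Finsupp.single 1 1, tsub_add_cancel_of_le ?_⟩
      simpa [Finsupp.single_le_iff] using Nat.one_le_iff_ne_zero.2 h0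
    simp [this]

theorem exists_coeff_ne_zero_of_dy_dy_ne_zero (h : dy (dy G) ≠ 0) :
    ∃ d : Fin 2 →₀ ℕ, 2 ≤ d 1 ∧ MvPowerSeries.coeff d G ≠ 0 := by
  obtain ⟨d, hd⟩ := MvPowerSeries.ne_zero_iff_exists_coeff_ne_zero _ |>.1 h
  simp only [dy, MvPowerSeries.coeff_pderiv] at hd
  exact ⟨d + Finsupp.single 1 1 + Finsupp.single 1 1, by simp,
    left_ne_zero_of_mul (left_ne_zero_of_mul hd)⟩

/-- The graph of `G(a, ·)` lies strictly above its tangent, the diagonal, away from a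
characteristic point. -/
theorem lt_of_hasValue (hG : WellConditioned G) {a b : ℝ} (hp : (a, b) ∈ charPoints G) {y v : ℝ}
    (hy : 0 ≤ y) (hne : y ≠ b) (h : HasValue G a y v) : y < v := by
  obtain ⟨ha, hb, h₀, h₁⟩ := hp
  -- The tangent at `b` has value `b + 1 * (y - b) = y`; it is then compared with `G(a, y)` monomial
  -- by monomial.
  have h₂ := HasSum.add h₀ ((hasSum_of_hasValue_dy h₁).mul_right (y - b))
  rw [one_mul, add_sub_cancel] at h₂
  obtain ⟨d₀, hd₀, hc⟩ := exists_coeff_ne_zero_of_dy_dy_ne_zero hG.nonlinear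
  have hc' : 0 < MvPowerSeries.coeff d₀ G * a ^ d₀ 0 :=
    mul_pos ((hG.nonneg _).lt_of_ne' hc) (pow_pos ha _)
  refine hasSum_lt (i := d₀) (fun d => ?_) ?_ h₂ h
  · have := mul_le_mul_of_nonneg_left (tangent_le_pow hb.le hy (d 1))
      (mul_nonneg (hG.nonneg d) (pow_nonneg ha.le (d 0)))
    simp only
    linarith
  · have := mul_lt_mul_of_pos_left (tangent_lt_pow hb hy hne hd₀) hc'
    simp only
    linarith

end Tangent

/-! ### Characteristic points are extreme points -/

section ExtremePoint

variable {G : MvPowerSeries (Fin 2) ℝ}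

theorem hasSum_solution (hG : WellConditioned G) {a b : ℝ} (hp : (a, b) ∈ charPoints G) :
    HasSum (fun n => PowerSeries.coeff n (solution G) * a ^ n) b := by
  have hT := isStandardSolution_solution hG
  obtain ⟨ha, hb, h₀, -⟩ := id hp
  have hle := eval_solution_le hG
    ((hasValue_iff_eval₂ hG.nonneg ha.le hb.le hb.le).1 h₀).le
  have htop : eval (solution G) (ENNReal.ofReal a) ≠ ∞ := ne_top_of_le_ne_top ENNReal.ofReal_ne_top hle
  set y := (eval (solution G) (ENNReal.ofReal a)).toReal with hy
  have hy₀ : 0 ≤ y := ENNReal.toReal_nonneg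
  have hval : eval (solution G) (ENNReal.ofReal a) = ENNReal.ofReal y :=
    (ENNReal.ofReal_toReal htop).symm
  have hyb : y = b := by
    by_contra hne
    have hfix := eval_eq_eval₂ hG hT (ENNReal.ofReal a)
    rw [hval] at hfix
    exact lt_irrefl y
      (lt_of_hasValue hG hp hy₀ hne ((hasValue_iff_eval₂ hG.nonneg ha.le hy₀ hy₀).2 hfix.symm))
  rw [hasSum_iff_eval hT.nonneg ha.le hb.le, hval, hyb]

theorem not_summable_solution (hG : WellConditioned G) {a b : ℝ} (hp : (a, b) ∈ charPoints G)
    {x : ℝ} (hx : a < x) :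
    ¬ Summable fun n => PowerSeries.coeff n (solution G) * x ^ n := by
  rintro ⟨y, hy⟩
  have hT := isStandardSolution_solution hG
  have ha : 0 < a := hp.1
  have hb : 0 < b := hp.2.1
  have hsum := hasSum_solution hG hp
  have hxpos : 0 < x := ha.trans hx
  have hby : b < y := by
    -- As `T(a) = b > 0` and `T(0) = 0`, some coefficient of positive index is positive, so `T`
    -- increases strictly.
    obtain ⟨n, hn⟩ : ∃ n, 0 < PowerSeries.coeff n (solution G) * a ^ n := by
      by_contra! hle
      exact hb.not_ge (hasSum_le hle hsum hasSum_zero)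
    have hn₀ : n ≠ 0 := by
      rintro rfl
      rw [PowerSeries.coeff_zero_eq_constantCoeff_apply, hT.constantCoeff_eq_zero] at hn
      simp at hn
    refine hasSum_lt (i := n) (fun m => ?_) ?_ hsum hy
    · exact mul_le_mul_of_nonneg_left (pow_le_pow_left₀ ha.le hx.le m) (hT.nonneg m)
    · exact mul_lt_mul_of_pos_left (pow_lt_pow_left₀ hx ha.le hn₀)
        (pos_of_mul_pos_left hn (pow_nonneg ha.le n))
  have hy₀ : 0 ≤ y := (hb.trans hby).le
  have hfix := eval_eq_eval₂ hG hT (ENNReal.ofReal x)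
  rw [(hasSum_iff_eval hT.nonneg hxpos.le hy₀).1 hy] at hfix
  have hle : eval₂ G (ENNReal.ofReal a) (ENNReal.ofReal y) ≤ ENNReal.ofReal y :=
    (eval₂_mono G (ENNReal.ofReal_le_ofReal hx.le) le_rfl).trans hfix.ge
  have htop := ne_top_of_le_ne_top ENNReal.ofReal_ne_top hle
  have := lt_of_hasValue hG hp hy₀ hby.ne' ((hasValue_iff_eval₂ hG.nonneg ha.le hy₀
    ENNReal.toReal_nonneg).2 (ENNReal.ofReal_toReal htop).symm)
  exact this.not_ge (ENNReal.toReal_le_of_le_ofReal hy₀ hle)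

theorem isExtremePoint_solution (hG : WellConditioned G) {a b : ℝ}
    (hp : (a, b) ∈ charPoints G) : IsExtremePoint (solution G) a b := by
  have hT := isStandardSolution_solution hG
  have ha : 0 < a := hp.1
  have hsum := hasSum_solution hG hp
  refine ⟨ha, le_antisymm ?_ ?_, hsum⟩
  · by_contra! hlt
    obtain ⟨r, hr, hr'⟩ := ENNReal.lt_iff_exists_nnreal_btwn.1 hlt
    have hs := FormalMultilinearSeries.summable_norm_mul_pow _ hr'
    simp only [FormalMultilinearSeries.ofScalars_norm, Real.norm_of_nonneg (hT.nonneg _)] at hs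
    refine not_summable_solution hG hp ?_ hs
    rw [← ENNReal.ofReal_coe_nnreal] at hr
    exact (ENNReal.ofReal_lt_ofReal_iff_of_nonneg ha.le).1 hr
  · refine FormalMultilinearSeries.le_radius_of_summable_norm _ ?_
    simp only [FormalMultilinearSeries.ofScalars_norm, Real.norm_of_nonneg (hT.nonneg _),
      Real.coe_toNNReal a ha.le]
    exact hsum.summable

theorem IsExtremePoint.unique {T : PowerSeries ℝ} {ρ τ ρ' τ' : ℝ} (h : IsExtremePoint T ρ τ)
    (h' : IsExtremePoint T ρ' τ') : ρ = ρ' ∧ τ = τ' := by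
  have hρ : ρ = ρ' := (ENNReal.ofReal_eq_ofReal_iff h.pos.le h'.pos.le).1
    (h.radius_eq.symm.trans h'.radius_eq)
  subst hρ
  exact ⟨rfl, h.hasSum.unique h'.hasSum⟩

end ExtremePoint

end OneEq

theorem mainTheorem5 (G : MvPowerSeries (Fin 2) ℝ) (hG : OneEq.WellConditioned G) :
    (OneEq.charPoints G).Subsingleton ∧
    ∃ T : PowerSeries ℝ, OneEq.IsStandardSolution G T ∧
      (∀ S : PowerSeries ℝ, OneEq.IsStandardSolution G S → S = T) ∧
      ∀ p ∈ OneEq.charPoints G, OneEq.IsExtremePoint T p.1 p.2 := by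
  refine ⟨?_, OneEq.solution G, OneEq.isStandardSolution_solution hG,
    fun S hS => hS.unique hG (OneEq.isStandardSolution_solution hG),
    fun p hp => OneEq.isExtremePoint_solution hG hp⟩
  intro p hp q hq
  have h := (OneEq.isExtremePoint_solution hG hp).unique (OneEq.isExtremePoint_solution hG hq)
  exact Prod.ext h.1 h.2
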